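/- **Theorem 1.5.** Let $n\ge 0$, and let $\mathcal K^n$ be the set of convex bodies (nonempty compact convex sets) in Euclidean space $\mathbb R^n$, let $B$ be the closed Euclidean unit ball of $\mathbb R^n$, and let $\kappa_i$ be the volume of the Euclidean unit ball of $\mathbb R^i$. For $K,E\in\mathcal K^n$ the relative quermassintegrals $W_i(K;E)$ are defined by Steiner's formula $\mathrm{vol}(K+tE)=\sum_{i=0}^n\binom ni W_i(K;E)\,t^i$ for all $t\ge 0$. The intrinsic volumes are $V_i(K)=\binom ni\kappa_{n-i}^{-1}\,W_{n-i}(K;B)$, and the Wills functional is $\mathcal W(K)=\sum_{i=0}^n V_i(K)$. (a) For all $K,L\in\mathcal K^n$ and $\lambda\in(0,1)$, $$\mathcal W\bigl((1-\lambda)K+\lambda L\bigr)\ \ge\ \mathcal W(K)^{1-\lambda}\,\mathcal W(L)^{\lambda}.$$ (b) More generally, let $E\in\mathcal K^n$ have the origin in its interior, and let $u:[0,\infty)\to\mathbb R\cup\{\infty\}$ be convex, increasing (not necessarily strictly) and continuous on $\{t\ge 0: u(t)\ne\infty\}$. For $K\in\mathcal K^n$ put $d_E(x,K)=\min\{t\ge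 0: x\in K+tE\}$ and $$\mathcal W_u(K;E)=\int_{\mathbb R^n}e^{-u(d_E(x,K))}\,dx\in[0,\infty].$$ Then, for all $K,L\in\mathcal K^n$ and $\lambda\in(0,1)$, $$\mathcal W_u\bigl((1-\lambda)K+\lambda L;E\bigr)\ \ge\ \mathcal W_u(K;E)^{1-\lambda}\,\mathcal W_u(L;E)^{\lambda}.$$ -/

import Mathlib

open MeasureTheory Polynomial
open scoped NNReal ENNReal Pointwise

noncomputable section

namespace WillsFunctional

/-- Convex bodies of `ℝⁿ`: nonempty compact convex subsets of Euclidean space. Mathlib equips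
them with Minkowski addition and dilation. -/
abbrev Body (n : ℕ) : Type := ConvexBody (EuclideanSpace ℝ (Fin n))

/-- The `n`-dimensional volume of a convex body, as a real number (it is always finite). -/
def vol {n : ℕ} (K : Body n) : ℝ :=
  (volume (K : Set (EuclideanSpace ℝ (Fin n)))).toReal

/-- The closed Euclidean unit ball of `ℝⁿ`. -/
def unitBall (n : ℕ) : Body n where
  carrier := Metric.closedBall 0 1
  convex' := convex_closedBall 0 1
  isCompact' := isCompact_closedBall 0 1
  nonempty' := ⟨0, Metric.mem_closedBall_self zero_le_one⟩

/-- `κₙ`, the volume of the Euclidean unit ball of `ℝⁿ`. -/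
def kappa (n : ℕ) : ℝ := vol (unitBall n)

/-- `p` is the polynomial of Steiner's formula for `K` relative to `E`: it has degree at most `n`
and `vol (K + t E) = p t` for all real `t ≥ 0`. -/
def IsSteinerPolynomial {n : ℕ} (K E : Body n) (p : ℝ[X]) : Prop :=
  p.natDegree ≤ n ∧ ∀ t : ℝ, 0 ≤ t → vol (K + t • E) = p.eval t

theorem IsSteinerPolynomial.unique {n : ℕ} {K E : Body n} {p q : ℝ[X]}
    (hp : IsSteinerPolynomial K E p) (hq : IsSteinerPolynomial K E q) : p = q := by
  apply Polynomial.eq_of_infinite_eval_eq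
  refine (Set.Ici_infinite (0 : ℝ)).mono fun t ht => ?_
  exact (hp.2 t ht).symm.trans (hq.2 t ht)

open Classical in
/-- The polynomial `t ↦ vol (K + t E)`. The value `0` of the second branch is never taken: by
Steiner's formula the polynomial exists for all convex bodies `K`, `E`. -/
def steinerPolynomial {n : ℕ} (K E : Body n) : ℝ[X] :=
  if h : ∃ p, IsSteinerPolynomial K E p then h.choose else 0

theorem IsSteinerPolynomial.eq_steinerPolynomial {n : ℕ} {K E : Body n} {p : ℝ[X]}
    (hp : IsSteinerPolynomial K E p) : steinerPolynomial K E = p := by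
  have h : ∃ p, IsSteinerPolynomial K E p := ⟨p, hp⟩
  rw [steinerPolynomial, dif_pos h]
  exact h.choose_spec.unique hp

/-- The relative quermassintegrals `Wᵢ(K; E)`, given by
`vol (K + t E) = ∑ i ≤ n, (n choose i) Wᵢ(K; E) tⁱ` for `t ≥ 0`. -/
def quermassintegral {n : ℕ} (i : ℕ) (K E : Body n) : ℝ :=
  (steinerPolynomial K E).coeff i / (n.choose i : ℝ)

/-- The intrinsic volumes `Vᵢ(K) = (n choose i) / κₙ₋ᵢ * Wₙ₋ᵢ(K; B)`, for `0 ≤ i ≤ n`. -/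
def intrinsicVolume {n : ℕ} (i : ℕ) (K : Body n) : ℝ :=
  (n.choose i : ℝ) / kappa (n - i) * quermassintegral (n - i) K (unitBall n)

/-- The Wills functional: the sum of the intrinsic volumes. -/
def wills {n : ℕ} (K : Body n) : ℝ :=
  ∑ i ∈ Finset.range (n + 1), intrinsicVolume i K

/-- The distance of `x` to `K` relative to `E`, `d_E(x, K) = min {t ≥ 0 | x ∈ K + t E}`
(for `0` in the interior of `E`, where this set is nonempty). -/
def relDist {n : ℕ} (E : Body n) (x : EuclideanSpace ℝ (Fin n)) (K : Body n) : ℝ≥0 :=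
  sInf {t : ℝ≥0 | x ∈ K + (t : ℝ) • E}

/-- The class of convex increasing (i.e. nondecreasing) functions `u : [0, ∞) → ℝ ∪ {∞}` that are
continuous on `{t | u t ≠ ∞}`. -/
structure IsConvexIncreasing (u : ℝ≥0 → EReal) : Prop where
  ne_bot : ∀ t, u t ≠ ⊥
  convex : ∀ (s t a b : ℝ≥0), 0 < a → 0 < b → a + b = 1 →
    u (a * s + b * t) ≤ ((a : ℝ) : EReal) * u s + ((b : ℝ) : EReal) * u t
  monotone : Monotone u
  continuousOn : ContinuousOn u {t | u t ≠ ⊤}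

/-- The generalized Wills functional `∫ exp (-u (d_E(x, K))) dx`, with values in `[0, ∞]`. -/
def genWills {n : ℕ} (u : ℝ≥0 → EReal) (K E : Body n) : ℝ≥0∞ :=
  ∫⁻ x : EuclideanSpace ℝ (Fin n), EReal.exp (-u (relDist E x K))

end WillsFunctional

end

namespace WillsFunctional

open Set

/-! Part (b) is Prékopa–Leindler. Since `E` is convex, the relative distance is jointly convex in
point and body (`relDist_convex_combination`). As `u` is convex and increasing, the functions `exp
(-u (d_E))` of the two bodies and of their combination satisfy the Prékopa–Leindler hypothesis.

Part (a) is the case `E = B`, `u t = π t ^ 2`. Writing `exp (-π d ^ 2)` as the integral of `2 π t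
exp (-π t ^ 2)` over `t ≥ d` and applying Fubini gives a weighted integral of `vol (K + t B)`. By
Steiner's formula this is a polynomial in `t`, and the `j`-th moment of the weight is `1 / κ_j`, so
the integral is the Wills functional (`genWills_gaussianExponent`).

Steiner's formula for `B` must itself be proved. Adding `t [0, v]` changes volume affinely in `t`,
so the volume is polynomial for zonotopes. The ball is a limit of zonotopes, and limits of
polynomials of degree at most `n` are again such polynomials. -/

/-! ### Brunn–Minkowski on the line -/

theorem geom_mean_le_arith_mean_ennreal {l : ℝ} (h0 : 0 < l) (h1 : l < 1) (a b : ℝ≥0∞) :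
    a ^ (1 - l) * b ^ l ≤ ENNReal.ofReal (1 - l) * a + ENNReal.ofReal l * b := by
  have h1' : 0 < 1 - l := sub_pos.2 h1
  have hp : ENNReal.ofReal (1 - l) ≠ 0 := by simpa using h1
  have hq : ENNReal.ofReal l ≠ 0 := by simpa using h0
  by_cases ha : a = ⊤
  · simp [ha, ENNReal.mul_top hp]
  by_cases hb : b = ⊤
  · simp [hb, ENNReal.mul_top hq]
  lift a to ℝ≥0 using ha
  lift b to ℝ≥0 using hb
  rw [← ENNReal.coe_rpow_of_nonneg _ h1'.le, ← ENNReal.coe_rpow_of_nonneg _ h0.le]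
  have := NNReal.geom_mean_le_arith_mean2_weighted (Real.toNNReal (1 - l)) (Real.toNNReal l) a b
    (by rw [← Real.toNNReal_add h1'.le h0.le]; simp)
  rw [Real.coe_toNNReal _ h1'.le, Real.coe_toNNReal _ h0.le] at this
  simpa [ENNReal.ofReal] using (ENNReal.coe_le_coe.2 this)

/-- One-dimensional Brunn–Minkowski inequality for compact sets. -/
theorem volume_add_le_of_isCompact {A B : Set ℝ} (hA : IsCompact A) (hB : IsCompact B)
    (hA' : A.Nonempty) (hB' : B.Nonempty) : volume A + volume B ≤ volume (A + B) := by
  -- With `a = max A` and `b = min B`, the translates `A + b` and `a + B` lie in `A + B` and meet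
  -- only at `a + b`.
  obtain ⟨a, ha, hamax⟩ := hA.exists_isGreatest hA'
  obtain ⟨b, hb, hbmin⟩ := hB.exists_isLeast hB'
  have hsub : ((fun x => x + b) '' A) ∪ ((fun x => a + x) '' B) ⊆ A + B := by
    rintro _ (⟨x, hx, rfl⟩ | ⟨x, hx, rfl⟩)
    · exact add_mem_add hx hb
    · exact add_mem_add ha hx
  have hdisj : AEDisjoint volume ((fun x => x + b) '' A) ((fun x => a + x) '' B) := by
    refine measure_mono_null (t := {a + b}) ?_ (by simp)
    rintro _ ⟨⟨x, hx, rfl⟩, ⟨y, hy, hxy⟩⟩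
    have h1 := hamax hx
    have h2 := hbmin hy
    simp only [mem_singleton_iff] at *
    linarith
  have hm : MeasurableSet ((fun x => a + x) '' B) :=
    (hB.image (continuous_const.add continuous_id)).measurableSet
  calc volume A + volume B
      = volume ((fun x => x + b) '' A) + volume ((fun x => a + x) '' B) := by simp
    _ = volume (((fun x => x + b) '' A) ∪ ((fun x => a + x) '' B)) :=
        (measure_union₀ hm.nullMeasurableSet hdisj).symm
    _ ≤ _ := measure_mono hsub

theorem volume_add_le_of_add_subset {A B C : Set ℝ} (hA : MeasurableSet A) (hB : MeasurableSet B)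
    (hA' : A.Nonempty) (hB' : B.Nonempty) (h : A + B ⊆ C) :
    volume A + volume B ≤ volume C := by
  obtain ⟨a, ha⟩ := hA'
  obtain ⟨b, hb⟩ := hB'
  rw [hA.measure_eq_iSup_isCompact, hB.measure_eq_iSup_isCompact]
  simp_rw [iSup_and']
  refine ENNReal.biSup_add_biSup_le' ⟨∅, by simp⟩ ⟨∅, by simp⟩ ?_
  rintro K ⟨hKA, hK⟩ L ⟨hLB, hL⟩
  -- The compact sets from inner regularity may be empty; adjoining a point makes the compact case
  -- applicable.
  calc volume K + volume L ≤ volume (insert a K) + volume (insert b L) := by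
        gcongr <;> exact subset_insert _ _
    _ ≤ volume (insert a K + insert b L) :=
        volume_add_le_of_isCompact (hK.insert a) (hL.insert b) (insert_nonempty _ _)
          (insert_nonempty _ _)
    _ ≤ volume C := measure_mono ((add_subset_add (insert_subset ha hKA)
        (insert_subset hb hLB)).trans h)

/-- One-dimensional Brunn–Minkowski inequality in weighted form. -/
theorem weighted_volume_add_le {A B C : Set ℝ} {l : ℝ} (h0 : 0 < l) (h1 : l < 1)
    (hA : MeasurableSet A) (hB : MeasurableSet B) (hA' : A.Nonempty) (hB' : B.Nonempty)
    (h : ∀ x ∈ A, ∀ y ∈ B, (1 - l) * x + l * y ∈ C) :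
    ENNReal.ofReal (1 - l) * volume A + ENNReal.ofReal l * volume B ≤ volume C := by
  have h1' : 0 < 1 - l := sub_pos.2 h1
  have := volume_add_le_of_add_subset (C := C) (hA.const_smul_of_ne_zero h1'.ne')
    (hB.const_smul_of_ne_zero h0.ne') hA'.smul_set hB'.smul_set (by
      rintro _ ⟨_, ⟨x, hx, rfl⟩, _, ⟨y, hy, rfl⟩, rfl⟩
      exact h x hx y hy)
  simpa [Measure.addHaar_smul, abs_of_pos h0, abs_of_pos h1'] using this

/-! ### The Prékopa–Leindler inequality -/

theorem lintegral_eq_lintegral_superlevel {f : ℝ → ℝ≥0∞} (hf : Measurable f)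
    (hf1 : ∀ x, f x ≤ 1) :
    ∫⁻ x, f x = ∫⁻ t in Ioi (0 : ℝ), volume {x | ENNReal.ofReal t < f x} := by
  have hne : ∀ x, f x ≠ ⊤ := fun x => ((hf1 x).trans_lt ENNReal.one_lt_top).ne
  have := lintegral_eq_lintegral_meas_lt volume (f := fun x => (f x).toReal)
    (Filter.Eventually.of_forall fun x => ENNReal.toReal_nonneg) hf.ennreal_toReal.aemeasurable
  simp only [ENNReal.ofReal_toReal (hne _)] at this
  rw [this]
  refine setLIntegral_congr_fun measurableSet_Ioi fun t ht => ?_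
  simp only [ENNReal.ofReal_lt_iff_lt_toReal (le_of_lt ht) (hne _)]

theorem antitone_superlevel (f : ℝ → ℝ≥0∞) :
    Antitone fun t : ℝ => volume {x | ENNReal.ofReal t < f x} := fun _ _ hst =>
  measure_mono fun _ hx => (ENNReal.ofReal_le_ofReal hst).trans_lt hx

/-- Equal suprema make `{f > t}` and `{g > t}` nonempty for the same levels `t < 1`. Their weighted
sum lies in `{h > t}`, so Brunn–Minkowski can be integrated over `t`. -/
theorem weighted_lintegral_add_le {f g h : ℝ → ℝ≥0∞} {l : ℝ} (h0 : 0 < l) (h1 : l < 1)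
    (hf : Measurable f) (hg : Measurable g) (hh : Measurable h)
    (hf1 : ⨆ x, f x = 1) (hg1 : ⨆ x, g x = 1)
    (H : ∀ x y, f x ^ (1 - l) * g y ^ l ≤ h ((1 - l) * x + l * y)) :
    ENNReal.ofReal (1 - l) * (∫⁻ x, f x) + ENNReal.ofReal l * (∫⁻ x, g x) ≤ ∫⁻ x, h x := by
  have h1' : 0 < 1 - l := sub_pos.2 h1
  have hfle : ∀ x, f x ≤ 1 := fun x => hf1 ▸ le_iSup f x
  have hgle : ∀ x, g x ≤ 1 := fun x => hg1 ▸ le_iSup g x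
  -- Only levels below 1 matter, so `h` may be cut off at 1.
  refine le_trans ?_ (lintegral_mono fun x => min_le_left (h x) 1)
  rw [lintegral_eq_lintegral_superlevel hf hfle, lintegral_eq_lintegral_superlevel hg hgle,
    lintegral_eq_lintegral_superlevel (hh.min measurable_const) fun x => min_le_right _ _,
    ← lintegral_const_mul _ (antitone_superlevel f).measurable,
    ← lintegral_const_mul _ (antitone_superlevel g).measurable,
    ← lintegral_add_left ((antitone_superlevel f).measurable.const_mul _)]
  refine setLIntegral_mono' measurableSet_Ioi fun t ht => ?_
  rcases lt_or_ge t 1 with ht1 | ht1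
  · have ht1' : ENNReal.ofReal t < 1 := by simpa using ht1
    refine weighted_volume_add_le h0 h1 (measurableSet_lt measurable_const hf)
      (measurableSet_lt measurable_const hg) (lt_iSup_iff.1 (hf1.symm ▸ ht1') :)
      (lt_iSup_iff.1 (hg1.symm ▸ ht1') :) fun x hx y hy => lt_min ?_ ht1'
    refine lt_of_lt_of_le ?_ (H x y)
    calc ENNReal.ofReal t = ENNReal.ofReal t ^ (1 - l) * ENNReal.ofReal t ^ l := by
          rw [← ENNReal.rpow_add_of_nonneg _ _ h1'.le h0.le]; simp
      _ < _ := ENNReal.mul_lt_mul (ENNReal.rpow_lt_rpow hx h1') (ENNReal.rpow_lt_rpow hy h0)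
  · have ht1' : 1 ≤ ENNReal.ofReal t := by simpa using ht1
    have e1 : {x | ENNReal.ofReal t < f x} = ∅ :=
      eq_empty_of_forall_notMem fun x hx => absurd hx (not_lt.2 ((hfle x).trans ht1'))
    have e2 : {x | ENNReal.ofReal t < g x} = ∅ :=
      eq_empty_of_forall_notMem fun x hx => absurd hx (not_lt.2 ((hgle x).trans ht1'))
    simp [e1, e2]

/-- The Prékopa–Leindler inequality with weight `l` for the measure `μ`. -/
def PrekopaLeindler {V : Type*} [AddCommGroup V] [Module ℝ V] [MeasurableSpace V]
    (μ : Measure V) (l : ℝ) : Prop :=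
  ∀ f g h : V → ℝ≥0∞, Measurable f → Measurable g → Measurable h →
    (∀ x y, f x ^ (1 - l) * g y ^ l ≤ h ((1 - l) • x + l • y)) →
    (∫⁻ x, f x ∂μ) ^ (1 - l) * (∫⁻ x, g x ∂μ) ^ l ≤ ∫⁻ x, h x ∂μ

/-- Both sides scale alike, so the suprema can be normalized to 1; the arithmetic mean then
dominates the geometric one. -/
theorem prekopaLeindler_real_of_bounded {f g h : ℝ → ℝ≥0∞} {l : ℝ} (h0 : 0 < l) (h1 : l < 1)
    (hf : Measurable f) (hg : Measurable g) (hh : Measurable h)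
    (hf1 : ⨆ x, f x ≠ ⊤) (hg1 : ⨆ x, g x ≠ ⊤)
    (H : ∀ x y, f x ^ (1 - l) * g y ^ l ≤ h ((1 - l) * x + l * y)) :
    (∫⁻ x, f x) ^ (1 - l) * (∫⁻ x, g x) ^ l ≤ ∫⁻ x, h x := by
  have h1' : 0 < 1 - l := sub_pos.2 h1
  set M := ⨆ x, f x with hM
  set N := ⨆ x, g x with hN
  by_cases hM0 : M = 0
  · have : ∀ x, f x = 0 := by simpa [hM0] using hM.symm
    simp [this, h1']
  by_cases hN0 : N = 0
  · have : ∀ x, g x = 0 := by simpa [hN0] using hN.symm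
    simp [this, h0]
  set c := M ^ (1 - l) * N ^ l with hc
  have hMp : M ^ (1 - l) ≠ 0 := by simp [ENNReal.rpow_eq_zero_iff, hM0, hf1]
  have hNp : N ^ l ≠ 0 := by simp [ENNReal.rpow_eq_zero_iff, hN0, hg1]
  have hMt : M ^ (1 - l) ≠ ⊤ := ENNReal.rpow_ne_top_of_nonneg h1'.le hf1
  have hNt : N ^ l ≠ ⊤ := ENNReal.rpow_ne_top_of_nonneg h0.le hg1
  have hc0 : c ≠ 0 := mul_ne_zero hMp hNp
  have hct : c ≠ ⊤ := ENNReal.mul_ne_top hMt hNt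
  have split : ∀ a b : ℝ≥0∞, (M⁻¹ * a) ^ (1 - l) * (N⁻¹ * b) ^ l
      = c⁻¹ * (a ^ (1 - l) * b ^ l) := by
    intro a b
    rw [ENNReal.mul_rpow_of_nonneg _ _ h1'.le, ENNReal.mul_rpow_of_nonneg _ _ h0.le,
      ENNReal.inv_rpow, ENNReal.inv_rpow, hc, ENNReal.mul_inv (Or.inl hMp) (Or.inr hNp)]
    ring
  have key := weighted_lintegral_add_le (f := fun x => M⁻¹ * f x) (g := fun x => N⁻¹ * g x)
    (h := fun x => c⁻¹ * h x) h0 h1 (hf.const_mul _) (hg.const_mul _) (hh.const_mul _)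
    (by rw [← ENNReal.mul_iSup, ← hM, ENNReal.inv_mul_cancel hM0 hf1])
    (by rw [← ENNReal.mul_iSup, ← hN, ENNReal.inv_mul_cancel hN0 hg1])
    (fun x y => by rw [split]; gcongr; exact H x y)
  have := (geom_mean_le_arith_mean_ennreal h0 h1 _ _).trans key
  rw [lintegral_const_mul _ hf, lintegral_const_mul _ hg, lintegral_const_mul _ hh, split] at this
  exact (ENNReal.mul_le_mul_iff_right (ENNReal.inv_ne_zero.2 hct) (ENNReal.inv_ne_top.2 hc0)).1 this

theorem prekopaLeindler_real {l : ℝ} (h0 : 0 < l) (h1 : l < 1) :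
    PrekopaLeindler (volume : Measure ℝ) l := by
  intro f g h hf hg hh H
  have h1' : 0 < 1 - l := sub_pos.2 h1
  have lim : ∀ {f : ℝ → ℝ≥0∞}, Measurable f →
      Filter.Tendsto (fun k : ℕ => ∫⁻ x, min (f x) k) Filter.atTop (nhds (∫⁻ x, f x)) := by
    intro f hf
    refine lintegral_tendsto_of_tendsto_of_monotone
      (fun k => (hf.min measurable_const).aemeasurable) ?_ ?_
    · exact .of_forall fun x i j hij => min_le_min_left _ (by exact_mod_cast hij)
    · refine .of_forall fun x => ?_
      have := (tendsto_const_nhds (x := f x)).min ENNReal.tendsto_nat_nhds_top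
      simpa using this
  have bdd : ∀ (f : ℝ → ℝ≥0∞) (k : ℕ), ⨆ x, min (f x) k ≠ ⊤ := fun f k =>
    ((iSup_le fun x => min_le_right _ _).trans_lt (ENNReal.natCast_lt_top k)).ne
  have le_of_truncate : ∀ k m : ℕ, (∫⁻ x, min (f x) k) ^ (1 - l) * (∫⁻ x, min (g x) m) ^ l ≤ ∫⁻ x, h x := by
    intro k m
    refine prekopaLeindler_real_of_bounded h0 h1 (hf.min measurable_const)
      (hg.min measurable_const) hh (bdd f k) (bdd g m) fun x y => le_trans ?_ (H x y)
    gcongr <;> exact min_le_left _ _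
  have le_of_truncate_left : ∀ k : ℕ, (∫⁻ x, min (f x) k) ^ (1 - l) * (∫⁻ x, g x) ^ l ≤ ∫⁻ x, h x := by
    intro k
    by_cases hz : (∫⁻ x, min (f x) k) ^ (1 - l) = 0
    · simp [hz]
    -- Multiplication by a possibly infinite constant is not continuous at 0, so a vanishing limit
    -- is treated apart.
    by_cases hg0 : (∫⁻ x, g x) ^ l = 0
    · simp [hg0]
    refine le_of_tendsto (ENNReal.Tendsto.const_mul
      ((ENNReal.continuous_rpow_const.tendsto _).comp (lim hg)) (Or.inl hg0))
      (.of_forall (le_of_truncate k))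
  by_cases hg0 : (∫⁻ x, f x) ^ (1 - l) = 0
  · simp [hg0]
  by_cases hgt : (∫⁻ x, g x) ^ l = 0
  · simp [hgt]
  exact le_of_tendsto (ENNReal.Tendsto.mul_const
    ((ENNReal.continuous_rpow_const.tendsto _).comp (lim hf)) (Or.inl hg0))
    (.of_forall le_of_truncate_left)

/-- By Tonelli: the inequality for `ν` on fibres is exactly the hypothesis that `μ` needs for the
fibre integrals. -/
theorem PrekopaLeindler.prod {V W : Type*} [AddCommGroup V] [Module ℝ V] [MeasurableSpace V]
    [AddCommGroup W] [Module ℝ W] [MeasurableSpace W] {μ : Measure V} {ν : Measure W}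
    [SFinite ν] {l : ℝ} (hμ : PrekopaLeindler μ l) (hν : PrekopaLeindler ν l) :
    PrekopaLeindler (μ.prod ν) l := by
  intro f g h hf hg hh H
  rw [lintegral_prod _ hf.aemeasurable, lintegral_prod _ hg.aemeasurable,
    lintegral_prod _ hh.aemeasurable]
  refine hμ _ _ _ hf.lintegral_prod_right' hg.lintegral_prod_right' hh.lintegral_prod_right' ?_
  intro x y
  exact hν _ _ _ (hf.comp measurable_prodMk_left) (hg.comp measurable_prodMk_left)
    (hh.comp measurable_prodMk_left) fun v w => H (x, v) (y, w)

theorem PrekopaLeindler.of_measurePreserving {V W : Type*} [AddCommGroup V] [Module ℝ V]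
    [MeasurableSpace V] [AddCommGroup W] [Module ℝ W] [MeasurableSpace W] {μ : Measure V}
    {ν : Measure W} {l : ℝ} (hμ : PrekopaLeindler μ l) (e : V →ₗ[ℝ] W)
    (he : MeasurePreserving e μ ν) : PrekopaLeindler ν l := by
  intro f g h hf hg hh H
  rw [← he.lintegral_comp hf, ← he.lintegral_comp hg, ← he.lintegral_comp hh]
  refine hμ _ _ _ (hf.comp he.measurable) (hg.comp he.measurable) (hh.comp he.measurable) ?_
  intro x y
  simpa using H (e x) (e y)

theorem prekopaLeindler_pi {l : ℝ} (h0 : 0 < l) (h1 : l < 1) (n : ℕ) :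
    PrekopaLeindler (volume : Measure (Fin n → ℝ)) l := by
  induction n with
  | zero =>
    intro f g h hf hg hh H
    rw [Measure.volume_pi_eq_dirac 0, lintegral_dirac' _ hf, lintegral_dirac' _ hg, lintegral_dirac' _ hh]
    simpa using H 0 0
  | succ n ih =>
    let e : (ℝ × (Fin n → ℝ)) →ₗ[ℝ] (Fin (n + 1) → ℝ) :=
      { toFun := fun p => Fin.cons p.1 p.2
        map_add' := fun p q => by ext i; refine Fin.cases ?_ (fun j => ?_) i <;> simp
        map_smul' := fun c p => by ext i; refine Fin.cases ?_ (fun j => ?_) i <;> simp }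
    refine ((prekopaLeindler_real h0 h1).prod ih).of_measurePreserving e ?_
    have he : ⇑e = ⇑(MeasurableEquiv.piFinSuccAbove (fun _ : Fin (n + 1) => ℝ) 0).symm := by
      funext p i
      refine Fin.cases ?_ (fun j => ?_) i <;> simp [e, MeasurableEquiv.piFinSuccAbove]
    rw [he]
    exact (volume_preserving_piFinSuccAbove (fun _ : Fin (n + 1) => ℝ) 0).symm

/-- The Prékopa–Leindler inequality in Euclidean space. -/
theorem prekopaLeindler_euclideanSpace {l : ℝ} (h0 : 0 < l) (h1 : l < 1) (n : ℕ) :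
    PrekopaLeindler (volume : Measure (EuclideanSpace ℝ (Fin n))) l :=
  (prekopaLeindler_pi h0 h1 n).of_measurePreserving
    (WithLp.linearEquiv 2 ℝ (Fin n → ℝ)).symm.toLinearMap
    (PiLp.volume_preserving_toLp (Fin n))

/-! ### The relative distance and log-concavity of the generalized functional -/

variable {n : ℕ}

/-- Projection along the compact `K × E` is a closed map. Hence the infimum in `relDist` is
attained. -/
theorem isClosed_setOf_mem_add_smul (E K : Body n) (x : EuclideanSpace ℝ (Fin n)) :
    IsClosed {t : ℝ≥0 | x ∈ K + (t : ℝ) • E} := by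
  have : CompactSpace K := isCompact_iff_compactSpace.1 K.isCompact
  have : CompactSpace E := isCompact_iff_compactSpace.1 E.isCompact
  have hc : IsClosed {p : ℝ≥0 × (↥K × ↥E) | (p.2.1 : EuclideanSpace ℝ (Fin n)) +
      (p.1 : ℝ) • (p.2.2 : EuclideanSpace ℝ (Fin n)) = x} :=
    isClosed_eq (by fun_prop) continuous_const
  convert isClosedMap_fst_of_compactSpace _ hc using 1
  ext t
  constructor
  · rintro ⟨k, hk, _, ⟨e, he, rfl⟩, rfl⟩
    exact ⟨(t, ⟨k, hk⟩, ⟨e, he⟩), rfl, rfl⟩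
  · rintro ⟨⟨s, k, e⟩, h, rfl⟩
    exact ⟨k, k.2, _, ⟨e, e.2, rfl⟩, h⟩

theorem add_smul_mono {E : Body n} (hE : (0 : EuclideanSpace ℝ (Fin n)) ∈ E) (K : Body n)
    {s t : ℝ≥0} (hst : s ≤ t) : K + (s : ℝ) • E ≤ K + (t : ℝ) • E := by
  refine add_subset_add_left (s := (K : Set (EuclideanSpace ℝ (Fin n)))) ?_
  exact E.smul_le_of_le hE hst

theorem exists_mem_add_smul {E : Body n}
    (hE : (0 : EuclideanSpace ℝ (Fin n)) ∈ interior (E : Set (EuclideanSpace ℝ (Fin n))))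
    (K : Body n) (x : EuclideanSpace ℝ (Fin n)) : ∃ t : ℝ≥0, x ∈ K + (t : ℝ) • E := by
  obtain ⟨k, hk⟩ := K.nonempty
  have habs : Absorbent ℝ (E : Set (EuclideanSpace ℝ (Fin n))) :=
    absorbent_nhds_zero (mem_interior_iff_mem_nhds.1 hE)
  obtain ⟨r, hr, h⟩ := (habs (x - k)).exists_pos
  refine ⟨⟨r, hr.le⟩, k, hk, x - k, ?_, by simp⟩
  exact h r (by simp [abs_of_pos hr]) (mem_singleton _)

/-- The infimum is attained and `K + t E` grows with `t`. Measurability, convexity and the later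
Fubini argument all rest on this. -/
theorem relDist_le_iff {E : Body n}
    (hE : (0 : EuclideanSpace ℝ (Fin n)) ∈ interior (E : Set (EuclideanSpace ℝ (Fin n))))
    {K : Body n} {x : EuclideanSpace ℝ (Fin n)} {t : ℝ≥0} :
    relDist E x K ≤ t ↔ x ∈ K + (t : ℝ) • E := by
  constructor
  · intro h
    exact add_smul_mono (interior_subset hE) K h
      ((isClosed_setOf_mem_add_smul E K x).csInf_mem (exists_mem_add_smul hE K x)
        (OrderBot.bddBelow _))
  · exact fun h => csInf_le (OrderBot.bddBelow _) h

theorem measurable_relDist {E : Body n}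
    (hE : (0 : EuclideanSpace ℝ (Fin n)) ∈ interior (E : Set (EuclideanSpace ℝ (Fin n))))
    (K : Body n) : Measurable fun x => relDist E x K := by
  refine measurable_of_Iic fun t => ?_
  have : (fun x => relDist E x K) ⁻¹' Iic t =
      ((K + (t : ℝ) • E : Body n) : Set (EuclideanSpace ℝ (Fin n))) := by
    ext x
    exact relDist_le_iff hE
  rw [this]
  exact (K + (t : ℝ) • E).isClosed.measurableSet

theorem relDist_convex_combination {E : Body n}
    (hE : (0 : EuclideanSpace ℝ (Fin n)) ∈ interior (E : Set (EuclideanSpace ℝ (Fin n))))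
    (K L : Body n) (x y : EuclideanSpace ℝ (Fin n)) (a b : ℝ≥0) :
    relDist E ((a : ℝ) • x + (b : ℝ) • y) ((a : ℝ) • K + (b : ℝ) • L) ≤
      a * relDist E x K + b * relDist E y L := by
  rw [relDist_le_iff hE]
  obtain ⟨k, hk, _, ⟨e, he, rfl⟩, hx⟩ := (relDist_le_iff hE).1 (le_refl (relDist E x K))
  obtain ⟨m, hm, _, ⟨f, hf, rfl⟩, hy⟩ := (relDist_le_iff hE).1 (le_refl (relDist E y L))
  refine ⟨(a : ℝ) • k + (b : ℝ) • m, ⟨_, ⟨k, hk, rfl⟩, _, ⟨m, hm, rfl⟩, rfl⟩,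
    (a : ℝ) • (relDist E x K : ℝ) • e + (b : ℝ) • (relDist E y L : ℝ) • f, ?_, ?_⟩
  · rw [smul_smul, smul_smul, NNReal.coe_add, NNReal.coe_mul, NNReal.coe_mul]
    -- Convexity of `E` enters here, as `(p + q) E = p E + q E`.
    have := E.convex.add_smul (p := (a : ℝ) * relDist E x K) (q := (b : ℝ) * relDist E y L)
      (by positivity) (by positivity)
    change _ ∈ (_ : ℝ) • (E : Set (EuclideanSpace ℝ (Fin n)))
    rw [this]
    exact ⟨_, ⟨e, he, rfl⟩, _, ⟨f, hf, rfl⟩, rfl⟩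
  · simp only at hx hy ⊢
    conv_rhs => rw [← hx, ← hy]
    module

theorem exp_neg_rpow_mul_le {u : ℝ≥0 → EReal} (hu : IsConvexIncreasing u) {a b : ℝ≥0}
    (ha : 0 < a) (hb : 0 < b) (hab : a + b = 1) (s t : ℝ≥0) :
    EReal.exp (-u s) ^ (a : ℝ) * EReal.exp (-u t) ^ (b : ℝ) ≤ EReal.exp (-u (a * s + b * t)) := by
  have ha' : (0 : ℝ) < a := ha
  have hb' : (0 : ℝ) < b := hb
  -- An infinite value makes the left side 0.
  by_cases hs : u s = ⊤
  · simp [hs, ha]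
  by_cases ht : u t = ⊤
  · simp [ht, hb]
  have hc := hu.convex s t a b ha hb hab
  have hs' := hu.ne_bot s
  have ht' := hu.ne_bot t
  generalize u s = p at *
  generalize u t = q at *
  lift p to ℝ using ⟨hs, hs'⟩
  lift q to ℝ using ⟨ht, ht'⟩
  calc EReal.exp (-(p : EReal)) ^ (a : ℝ) * EReal.exp (-(q : EReal)) ^ (b : ℝ)
      = EReal.exp (-(((a : ℝ) : EReal) * p + ((b : ℝ) : EReal) * q)) := by
        norm_cast
        rw [EReal.exp_coe, EReal.exp_coe, EReal.exp_coe,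
          ENNReal.ofReal_rpow_of_pos (Real.exp_pos _), ENNReal.ofReal_rpow_of_pos (Real.exp_pos _),
          ← ENNReal.ofReal_mul (by positivity), ← Real.exp_mul, ← Real.exp_mul, ← Real.exp_add]
        congr 2
        ring
    _ ≤ _ := EReal.exp_monotone (EReal.neg_le_neg_iff.2 hc)

theorem measurable_exp_neg_relDist {u : ℝ≥0 → EReal} (hu : IsConvexIncreasing u) {E : Body n}
    (hE : (0 : EuclideanSpace ℝ (Fin n)) ∈ interior (E : Set (EuclideanSpace ℝ (Fin n))))
    (K : Body n) : Measurable fun x => EReal.exp (-u (relDist E x K)) :=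
  EReal.measurable_exp.comp (hu.monotone.measurable.comp (measurable_relDist hE K)).neg

/-- Log-concavity of the generalized Wills functional. -/
theorem genWills_rpow_mul_le {E : Body n}
    (hE : (0 : EuclideanSpace ℝ (Fin n)) ∈ interior (E : Set (EuclideanSpace ℝ (Fin n))))
    {u : ℝ≥0 → EReal} (hu : IsConvexIncreasing u) (K L : Body n) {l : ℝ} (h0 : 0 < l)
    (h1 : l < 1) :
    genWills u K E ^ (1 - l) * genWills u L E ^ l ≤ genWills u ((1 - l) • K + l • L) E := by
  refine prekopaLeindler_euclideanSpace h0 h1 n _ _ _ (measurable_exp_neg_relDist hu hE K)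
    (measurable_exp_neg_relDist hu hE L) (measurable_exp_neg_relDist hu hE _) fun x y => ?_
  lift l to ℝ≥0 using h0.le
  obtain ⟨a, ha⟩ : ∃ a : ℝ≥0, (a : ℝ) = 1 - l := ⟨⟨1 - l, sub_nonneg.2 h1.le⟩, rfl⟩
  rw [← ha]
  refine (exp_neg_rpow_mul_le hu (a := a) (b := l) ?_ h0 ?_ _ _).trans ?_
  · rw [← NNReal.coe_pos, ha]
    linarith
  · rw [← NNReal.coe_inj, NNReal.coe_add, ha]
    simp
  · exact EReal.exp_monotone (EReal.neg_le_neg_iff.2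
      (hu.monotone (relDist_convex_combination hE K L x y a l)))

/-! ### Steiner's formula for zonotopes -/

/-- The segment `[0, v]` as a convex body. -/
def segmentBody (v : EuclideanSpace ℝ (Fin n)) : Body n where
  carrier := LinearMap.toSpanSingleton ℝ _ v '' Icc 0 1
  convex' := (convex_Icc 0 1).linear_image _
  isCompact' := isCompact_Icc.image (by simpa using by fun_prop)
  nonempty' := (nonempty_Icc.2 zero_le_one).image _

theorem mem_segmentBody {v x : EuclideanSpace ℝ (Fin n)} :
    x ∈ segmentBody v ↔ ∃ r : ℝ, 0 ≤ r ∧ r ≤ 1 ∧ r • v = x := by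
  change x ∈ LinearMap.toSpanSingleton ℝ _ v '' Icc 0 1 ↔ _
  simp [and_assoc]

theorem mem_add_smul_segmentBody {K : Body n} {v x : EuclideanSpace ℝ (Fin n)} {t : ℝ}
    (ht : 0 ≤ t) :
    x ∈ K + t • segmentBody v ↔ ∃ r : ℝ, 0 ≤ r ∧ r ≤ t ∧ x - r • v ∈ K := by
  constructor
  · rintro ⟨k, hk, _, ⟨_, ⟨r, ⟨hr0, hr1⟩, rfl⟩, rfl⟩, rfl⟩
    exact ⟨t * r, by positivity, mul_le_of_le_one_right ht hr1, by simpa [mul_smul] using hk⟩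
  · rintro ⟨r, hr0, hrt, hk⟩
    refine ⟨_, hk, r • v, ⟨(r / t) • v, mem_segmentBody.2 ⟨r / t, by positivity,
      div_le_one_of_le₀ hrt ht, rfl⟩, ?_⟩, by simp⟩
    rcases ht.eq_or_lt with rfl | ht
    · simp [le_antisymm hrt hr0]
    · simp [smul_smul, mul_div_cancel₀ _ ht.ne']

/-- Each line parallel to `v` meets `K` in a possibly empty segment, and adding multiples of `[0,
v]` only pushes its far end forward. Hence the volume gained is additive in the multiple. -/
theorem add_smul_segmentBody_diff (K : Body n) (v : EuclideanSpace ℝ (Fin n)) {s t : ℝ}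
    (hs : 0 ≤ s) (ht : 0 ≤ t) :
    ((K + (s + t) • segmentBody v : Body n) : Set (EuclideanSpace ℝ (Fin n))) \
        (K + s • segmentBody v : Body n) =
      (s • v) +ᵥ (((K + t • segmentBody v : Body n) : Set (EuclideanSpace ℝ (Fin n))) \ K) := by
  ext x
  rw [mem_vadd_set_iff_neg_vadd_mem, vadd_eq_add, neg_add_eq_sub]
  simp only [mem_sdiff, SetLike.mem_coe, mem_add_smul_segmentBody hs, mem_add_smul_segmentBody ht,
    mem_add_smul_segmentBody (add_nonneg hs ht)]
  constructor
  · rintro ⟨⟨r, hr0, hrst, hr⟩, hx⟩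
    push Not at hx
    refine ⟨⟨r - s, ?_, by linarith, by convert hr using 1; module⟩, hx s hs le_rfl⟩
    by_contra! h
    exact hx r hr0 (by linarith) hr
  · rintro ⟨⟨r, hr0, hrt, hr⟩, hx⟩
    refine ⟨⟨r + s, by linarith, by linarith, by convert hr using 1; module⟩, ?_⟩
    rintro ⟨q, hq0, hqs, hq⟩
    apply hx
    -- As `q ≤ s ≤ s + r`, the point `x - s • v` lies between two points of `K`; if these coincide,
    -- `q = s`.
    rcases (add_nonneg hr0 (sub_nonneg.2 hqs)).eq_or_lt with h | h
    · rw [show s = q by linarith]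
      exact hq
    · have h1 : (r / (r + (s - q))) + ((s - q) / (r + (s - q))) = 1 := by
        rw [← add_div, div_self h.ne']
      have := K.convex hq hr (div_nonneg hr0 h.le) (div_nonneg (sub_nonneg.2 hqs) h.le) h1
      have e : x - s • v = (r / (r + (s - q))) • (x - q • v) +
          ((s - q) / (r + (s - q))) • (x - s • v - r • v) := by
        match_scalars <;> field_simp
        ring
      rw [e]
      exact this

theorem volume_ne_top (K : Body n) : volume (K : Set (EuclideanSpace ℝ (Fin n))) ≠ ⊤ :=
  K.isCompact.measure_ne_top

theorem vol_mono {K L : Body n} (h : K ≤ L) : vol K ≤ vol L :=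
  ENNReal.toReal_mono (volume_ne_top L) (measure_mono h)

theorem vol_add_smul_segmentBody_add (K : Body n) (v : EuclideanSpace ℝ (Fin n)) {s t : ℝ}
    (hs : 0 ≤ s) (ht : 0 ≤ t) :
    vol (K + (s + t) • segmentBody v) - vol K =
      (vol (K + s • segmentBody v) - vol K) + (vol (K + t • segmentBody v) - vol K) := by
  have sub1 : ((K + s • segmentBody v : Body n) : Set (EuclideanSpace ℝ (Fin n))) ⊆
      (K + (s + t) • segmentBody v : Body n) := fun x hx => by
    obtain ⟨r, h0, h1, h⟩ := (mem_add_smul_segmentBody hs).1 hx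
    exact (mem_add_smul_segmentBody (add_nonneg hs ht)).2 ⟨r, h0, by linarith, h⟩
  have sub2 : (K : Set (EuclideanSpace ℝ (Fin n))) ⊆ (K + t • segmentBody v : Body n) :=
    fun x hx => (mem_add_smul_segmentBody ht).2 ⟨0, le_rfl, ht, by simpa using hx⟩
  have h := congrArg volume.real (add_smul_segmentBody_diff K v hs ht)
  rw [measureReal_sdiff sub1 (ConvexBody.isClosed _).measurableSet (volume_ne_top _),
    show volume.real (s • v +ᵥ _) = volume.real _ from congrArg ENNReal.toReal (measure_vadd _ _ _),
    measureReal_sdiff sub2 (ConvexBody.isClosed _).measurableSet (volume_ne_top _)] at h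
  simp only [vol, ← measureReal_def]
  linarith

/-- A monotone additive function on the nonnegative reals is linear. -/
theorem eq_mul_of_additive_of_monotone {h : ℝ → ℝ}
    (hadd : ∀ s t, 0 ≤ s → 0 ≤ t → h (s + t) = h s + h t)
    (hmono : ∀ s t, 0 ≤ s → s ≤ t → h s ≤ h t) {t : ℝ} (ht : 0 ≤ t) : h t = t * h 1 := by
  have hnat : ∀ (m : ℕ) (s : ℝ), 0 ≤ s → h (m * s) = m * h s := by
    intro m s hs
    induction m with
    | zero =>
      have := hadd 0 0 le_rfl le_rfl
      simp only [add_zero] at this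
      simp only [CharP.cast_eq_zero, zero_mul]
      linarith
    | succ m ih =>
      rw [Nat.cast_succ, add_mul, one_mul, hadd _ _ (by positivity) hs, ih]
      ring
  -- Comparing `h (N t)` with its values at the integers around `N t` gives an error bound
  -- independent of `N`.
  have key : ∀ N : ℕ, N * |h t - t * h 1| ≤ h 1 := by
    intro N
    have hNt : 0 ≤ N * t := by positivity
    have h1 := Nat.floor_le hNt
    have h2 := (Nat.lt_floor_add_one (N * t)).le
    have h3 := hmono _ _ (Nat.cast_nonneg _) h1
    have h4 := hmono _ _ hNt h2
    have e1 := hnat ⌊N * t⌋₊ 1 zero_le_one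
    have e2 := hnat (⌊N * t⌋₊ + 1) 1 zero_le_one
    push_cast at e2
    rw [mul_one] at e1 e2
    rw [hnat N t ht] at h3 h4
    rw [e1] at h3
    rw [e2] at h4
    have hpos : 0 ≤ h 1 := by
      have := hmono 0 1 le_rfl zero_le_one
      have h0 := hnat 0 1 zero_le_one
      simp only [CharP.cast_eq_zero, zero_mul] at h0
      linarith
    have h5 := mul_le_mul_of_nonneg_right h1 hpos
    have h6 := mul_le_mul_of_nonneg_right h2 hpos
    rw [← abs_of_nonneg (Nat.cast_nonneg (α := ℝ) N), ← abs_mul, abs_le]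
    constructor <;> nlinarith
  by_contra hne
  obtain ⟨N, hN⟩ := exists_nat_gt (h 1 / |h t - t * h 1|)
  have hp : 0 < |h t - t * h 1| := abs_pos.2 (sub_ne_zero.2 hne)
  rw [div_lt_iff₀ hp] at hN
  exact absurd (key N) (not_le.2 hN)

theorem vol_add_smul_segmentBody (K : Body n) (v : EuclideanSpace ℝ (Fin n)) {t : ℝ}
    (ht : 0 ≤ t) :
    vol (K + t • segmentBody v) = (1 - t) * vol K + t * vol (K + segmentBody v) := by
  have := eq_mul_of_additive_of_monotone (h := fun t => vol (K + t • segmentBody v) - vol K)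
    (fun s t => vol_add_smul_segmentBody_add K v) (fun s t hs hst => sub_le_sub_right
      (vol_mono fun x hx => by
        obtain ⟨r, h0, h1, h⟩ := (mem_add_smul_segmentBody hs).1 hx
        exact (mem_add_smul_segmentBody (hs.trans hst)).2 ⟨r, h0, h1.trans hst, h⟩) _) ht
  simp only [one_smul] at this
  linarith

/-- Zonotopes: finite sums of segments `[0, v]`. -/
inductive IsZonotope : Body n → Prop
  | zero : IsZonotope 0
  | segment_add (v : EuclideanSpace ℝ (Fin n)) {Z : Body n} :
      IsZonotope Z → IsZonotope (segmentBody v + Z)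

theorem IsZonotope.add {Y Z : Body n} (hY : IsZonotope Y) (hZ : IsZonotope Z) :
    IsZonotope (Y + Z) := by
  induction hY with
  | zero => rwa [zero_add]
  | segment_add v _ ih => rw [add_assoc]; exact ih.segment_add v

theorem smul_segmentBody (c : ℝ) (v : EuclideanSpace ℝ (Fin n)) :
    c • segmentBody v = segmentBody (c • v) := by
  ext x
  constructor
  · rintro ⟨_, ⟨r, hr, rfl⟩, rfl⟩
    exact ⟨r, hr, smul_comm r c v⟩
  · rintro ⟨r, hr, rfl⟩
    exact ⟨_, ⟨r, hr, rfl⟩, smul_comm c r v⟩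

theorem smul_zero_body (c : ℝ) : c • (0 : Body n) = 0 :=
  SetLike.coe_injective (smul_zero (A := Set (EuclideanSpace ℝ (Fin n))) c)

theorem IsZonotope.smul {Z : Body n} (hZ : IsZonotope Z) (c : ℝ) : IsZonotope (c • Z) := by
  induction hZ with
  | zero => rw [smul_zero_body]; exact .zero
  | segment_add v _ ih => rw [smul_add, smul_segmentBody]; exact ih.segment_add _

/-- Splitting off one segment leaves `(1 - t) vol (K + t Z) + t vol (K + [0, v] + t Z)`. The
induction must range over all `K`, since the second term changes it. -/
theorem IsZonotope.exists_polynomial {Z : Body n} (hZ : IsZonotope Z) (K : Body n) :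
    ∃ p : ℝ[X], ∀ t : ℝ, 0 ≤ t → vol (K + t • Z) = p.eval t := by
  induction hZ generalizing K with
  | zero => exact ⟨C (vol K), fun t _ => by rw [smul_zero_body, add_zero, eval_C]⟩
  | @segment_add v Z _ ih =>
    obtain ⟨p, hp⟩ := ih K
    obtain ⟨q, hq⟩ := ih (K + segmentBody v)
    refine ⟨(1 - X) * p + X * q, fun t ht => ?_⟩
    have h1 := hp t ht
    have h2 := hq t ht
    rw [add_right_comm] at h2
    rw [smul_add, add_comm (t • segmentBody v), ← add_assoc, vol_add_smul_segmentBody _ _ ht,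
      h1, h2]
    simp

/-- Comparison with a ball of radius `R (1 + t)`. This growth rate caps the degree at `n`, whereas
the induction over segments only bounds it by their number. -/
theorem exists_vol_add_smul_le (K E : Body n) :
    ∃ C : ℝ, ∀ t : ℝ, 0 ≤ t → vol (K + t • E) ≤ C * (1 + t) ^ n := by
  obtain ⟨R, hR⟩ := (K.isBounded.union E.isBounded).subset_closedBall 0
  have hK : ∀ x ∈ K, ‖x‖ ≤ R := fun x hx => by simpa using hR (Or.inl hx)
  have hE : ∀ x ∈ E, ‖x‖ ≤ R := fun x hx => by simpa using hR (Or.inr hx)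
  have hR0 : 0 ≤ R := by
    obtain ⟨x, hx⟩ := K.nonempty
    exact (norm_nonneg x).trans (hK x hx)
  refine ⟨R ^ n * vol (unitBall n), fun t ht => ?_⟩
  have hsub : ((K + t • E : Body n) : Set (EuclideanSpace ℝ (Fin n))) ⊆
      Metric.closedBall 0 (R * (1 + t)) := by
    rintro _ ⟨k, hk, _, ⟨e, he, rfl⟩, rfl⟩
    rw [mem_closedBall_zero_iff]
    calc ‖k + t • e‖ ≤ ‖k‖ + t * ‖e‖ := by
          refine (norm_add_le _ _).trans_eq ?_
          rw [norm_smul, Real.norm_of_nonneg ht]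
      _ ≤ R + t * R := by gcongr; exacts [hK k hk, hE e he]
      _ = _ := by ring
  have := ENNReal.toReal_mono measure_closedBall_lt_top.ne (measure_mono (μ := volume) hsub)
  rw [Measure.addHaar_closedBall' _ _ (by positivity)] at this
  simp only [finrank_euclideanSpace, Fintype.card_fin, ENNReal.toReal_mul] at this
  rw [ENNReal.toReal_ofReal (by positivity)] at this
  refine this.trans_eq ?_
  rw [mul_pow]
  simp only [vol, unitBall]
  change _ = R ^ n * (volume (Metric.closedBall (0 : EuclideanSpace ℝ (Fin n)) 1)).toReal * _
  ring

theorem natDegree_le_of_abs_eval_le {p : ℝ[X]} {C : ℝ} {n : ℕ}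
    (h : ∀ t : ℝ, 0 ≤ t → |p.eval t| ≤ C * (1 + t) ^ n) : p.natDegree ≤ n := by
  by_contra! hn
  have hq : ((1 + X : ℝ[X]) ^ n).natDegree = n := by
    rw [natDegree_pow, add_comm, ← C_1, natDegree_X_add_C, mul_one]
  have hq0 : ((1 + X : ℝ[X]) ^ n) ≠ 0 := by
    rw [add_comm, ← C_1]
    exact pow_ne_zero _ (X_add_C_ne_zero _)
  have hlim := Polynomial.abs_div_tendsto_atTop_atTop_of_degree_gt p ((1 + X) ^ n)
    (degree_lt_degree (by rwa [hq])) hq0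
  obtain ⟨t, ht, ht0⟩ := ((hlim.eventually_gt_atTop C).and
    (Filter.eventually_ge_atTop 0)).exists
  have hpos : 0 < (1 + t) ^ n := by positivity
  simp only [eval_pow, eval_add, eval_one, eval_X] at ht
  rw [abs_div, abs_of_pos hpos, lt_div_iff₀ hpos] at ht
  exact absurd (h t ht0) (not_le.2 ht)

theorem IsZonotope.exists_isSteinerPolynomial {Z : Body n} (hZ : IsZonotope Z) (K : Body n) :
    ∃ p, IsSteinerPolynomial K Z p := by
  obtain ⟨p, hp⟩ := hZ.exists_polynomial K
  obtain ⟨C, hC⟩ := exists_vol_add_smul_le K Z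
  refine ⟨p, natDegree_le_of_abs_eval_le (C := C) fun t ht => ?_, hp⟩
  rw [← hp t ht, abs_of_nonneg (show 0 ≤ vol _ from ENNReal.toReal_nonneg)]
  exact hC t ht

/-- Pointwise limits of polynomials of bounded degree are polynomials. -/
theorem exists_polynomial_of_tendsto {n : ℕ} {f : ℝ → ℝ} {p : ℕ → ℝ[X]}
    (hdeg : ∀ k, (p k).natDegree ≤ n)
    (hlim : ∀ t : ℝ, 0 ≤ t → Filter.Tendsto (fun k => (p k).eval t) Filter.atTop (nhds (f t))) :
    ∃ q : ℝ[X], q.natDegree ≤ n ∧ ∀ t : ℝ, 0 ≤ t → f t = q.eval t := by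
  have hinj : InjOn (fun i : ℕ => (i : ℝ)) (Finset.range (n + 1)) := Nat.cast_injective.injOn
  refine ⟨Lagrange.interpolate (Finset.range (n + 1)) (fun i : ℕ => (i : ℝ)) (fun i => f i),
    ?_, fun t ht => ?_⟩
  · rw [natDegree_le_iff_degree_le]
    simpa using Lagrange.degree_interpolate_le (r := fun i : ℕ => f i) hinj
  · refine tendsto_nhds_unique (hlim t ht) ?_
    -- Interpolation at `0, …, n` recovers each `p k` with coefficients independent of `k`, so the
    -- limit passes through the sum.
    have : ∀ k, (p k).eval t = ∑ i ∈ Finset.range (n + 1),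
        (p k).eval (i : ℝ) * (Lagrange.basis (Finset.range (n + 1)) (fun i : ℕ => (i : ℝ)) i).eval t := by
      intro k
      have hk := Lagrange.eq_interpolate (f := p k) hinj
        (by
          rw [Finset.card_range]
          exact (degree_le_of_natDegree_le (hdeg k)).trans_lt (by exact_mod_cast n.lt_succ_self))
      conv_lhs => rw [hk]
      simp [Lagrange.interpolate_apply, eval_finsetSum]
    simp_rw [this, Lagrange.interpolate_apply, eval_finsetSum, eval_mul, eval_C]
    exact tendsto_finsetSum _ fun i _ => (hlim i (Nat.cast_nonneg i)).mul_const _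

/-! ### Approximating the ball by zonotopes -/

theorem IsZonotope.segmentBody (v : EuclideanSpace ℝ (Fin n)) : IsZonotope (segmentBody v) := by
  simpa using IsZonotope.zero.segment_add v

/-- The closed Euclidean unit ball as a type. -/
abbrev ClosedUnitBall (n : ℕ) : Type := Metric.closedBall (0 : EuclideanSpace ℝ (Fin n)) 1

/-- `φ` is the support function of `Z` on the unit ball. -/
def IsSupportFunction (Z : Body n)
    (φ : C(ClosedUnitBall n, ℝ)) : Prop :=
  ∀ u : ClosedUnitBall n, (∀ z ∈ Z, inner ℝ (u : EuclideanSpace ℝ (Fin n)) z ≤ φ u) ∧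
    ∃ z ∈ Z, inner ℝ (u : EuclideanSpace ℝ (Fin n)) z = φ u

theorem IsSupportFunction.add {Y Z : Body n}
    {φ ψ : C(ClosedUnitBall n, ℝ)}
    (hY : IsSupportFunction Y φ) (hZ : IsSupportFunction Z ψ) :
    IsSupportFunction (Y + Z) (φ + ψ) := by
  intro u
  obtain ⟨hy, y, hyY, hye⟩ := hY u
  obtain ⟨hz, z, hzZ, hze⟩ := hZ u
  constructor
  · rintro _ ⟨a, ha, b, hb, rfl⟩
    simpa [inner_add_right] using add_le_add (hy a ha) (hz b hb)
  · exact ⟨y + z, add_mem_add hyY hzZ, by simp [inner_add_right, hye, hze]⟩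

theorem IsSupportFunction.smul {Z : Body n}
    {φ : C(ClosedUnitBall n, ℝ)}
    (hZ : IsSupportFunction Z φ) {c : ℝ} (hc : 0 ≤ c) : IsSupportFunction (c • Z) (c • φ) := by
  intro u
  obtain ⟨hz, z, hzZ, hze⟩ := hZ u
  constructor
  · rintro _ ⟨a, ha, rfl⟩
    simpa [inner_smul_right] using mul_le_mul_of_nonneg_left (hz a ha) hc
  · exact ⟨c • z, smul_mem_smul_set hzZ, by simp [inner_smul_right, hze]⟩

/-- The support function of the segment `[0, v]`, as a continuous function of `v`. -/
noncomputable def segmentSupport (n : ℕ) : C(EuclideanSpace ℝ (Fin n), C(ClosedUnitBall n, ℝ)) :=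
  ContinuousMap.curry ⟨fun p => max (inner ℝ (p.2 : EuclideanSpace ℝ (Fin n)) p.1) 0, by fun_prop⟩

theorem segmentSupport_apply (v : EuclideanSpace ℝ (Fin n))
    (u : ClosedUnitBall n) :
    segmentSupport n v u = max (inner ℝ (u : EuclideanSpace ℝ (Fin n)) v) 0 := rfl

theorem isSupportFunction_segmentBody (v : EuclideanSpace ℝ (Fin n)) :
    IsSupportFunction (segmentBody v) (segmentSupport n v) := by
  intro u
  rw [segmentSupport_apply]
  constructor
  · intro z hz
    obtain ⟨r, hr0, hr1, rfl⟩ := mem_segmentBody.1 hz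
    rw [inner_smul_right]
    rcases le_total 0 (inner ℝ (u : EuclideanSpace ℝ (Fin n)) v) with h | h
    · exact le_max_of_le_left (mul_le_of_le_one_left h hr1)
    · exact le_max_of_le_right (mul_nonpos_of_nonneg_of_nonpos hr0 h)
  · rcases le_total 0 (inner ℝ (u : EuclideanSpace ℝ (Fin n)) v) with h | h
    · exact ⟨v, mem_segmentBody.2 ⟨1, zero_le_one, le_rfl, one_smul _ _⟩, (max_eq_left h).symm⟩
    · exact ⟨0, mem_segmentBody.2 ⟨0, le_rfl, zero_le_one, zero_smul _ _⟩, by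
        rw [max_eq_right h, inner_zero_right]⟩

/-- The average of `⟨u, v⟩⁺` over the unit ball depends only on the norm of `u`. -/
theorem setIntegral_inner_posPart_eq {u u' : EuclideanSpace ℝ (Fin n)} (h : ‖u‖ = ‖u'‖) :
    ∫ v in Metric.closedBall (0 : EuclideanSpace ℝ (Fin n)) 1, max (inner ℝ u v) 0 =
      ∫ v in Metric.closedBall (0 : EuclideanSpace ℝ (Fin n)) 1, max (inner ℝ u' v) 0 := by
  -- For equal norms, reflection in the hyperplane orthogonal to `u - u'` takes `u` to `u'`; it
  -- preserves the ball and volume.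
  let T : EuclideanSpace ℝ (Fin n) ≃ₗᵢ[ℝ] EuclideanSpace ℝ (Fin n) :=
    (ℝ ∙ (u - u'))ᗮ.reflection
  have hT : T u = u' := Submodule.reflection_sub h
  have hpre : T ⁻¹' Metric.closedBall 0 1 = Metric.closedBall 0 1 := by
    ext v
    simp
  have := T.measurePreserving.setIntegral_preimage_emb T.toMeasurableEquiv.measurableEmbedding
    (fun v => max (inner ℝ u' v) 0) (Metric.closedBall 0 1)
  rw [hpre] at this
  rw [← this, ← hT]
  simp [T.inner_map_map]

theorem setIntegral_inner_posPart_pos {u : EuclideanSpace ℝ (Fin n)} (hu : ‖u‖ = 1) :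
    0 < ∫ v in Metric.closedBall (0 : EuclideanSpace ℝ (Fin n)) 1, max (inner ℝ u v) 0 := by
  have hcont : Continuous fun v : EuclideanSpace ℝ (Fin n) => max (inner ℝ u v) 0 := by fun_prop
  refine (setIntegral_pos_iff_support_of_nonneg_ae (.of_forall fun v => le_max_right _ _)
    (hcont.continuousOn.integrableOn_compact (isCompact_closedBall _ _))).2 ?_
  have hopen : IsOpen ({v : EuclideanSpace ℝ (Fin n) | 0 < inner ℝ u v} ∩ Metric.ball 0 1) :=
    (isOpen_lt continuous_const (by fun_prop)).inter Metric.isOpen_ball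
  refine (hopen.measure_pos volume ⟨(1 / 2 : ℝ) • u, ?_, ?_⟩).trans_le (measure_mono ?_)
  · simp [inner_smul_right, hu]
  · simp [norm_smul, hu]
    norm_num
  · rintro v ⟨hv, hv'⟩
    exact ⟨(lt_max_of_lt_left hv).ne', Metric.ball_subset_closedBall hv'⟩

theorem average_segmentSupport_apply (u : ClosedUnitBall n) :
    (⨍ v in Metric.closedBall (0 : EuclideanSpace ℝ (Fin n)) 1, segmentSupport n v) u =
      (volume.real (Metric.closedBall (0 : EuclideanSpace ℝ (Fin n)) 1))⁻¹ *
        ∫ v in Metric.closedBall (0 : EuclideanSpace ℝ (Fin n)) 1,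
          max (inner ℝ (u : EuclideanSpace ℝ (Fin n)) v) 0 := by
  have hint : IntegrableOn (segmentSupport n) (Metric.closedBall 0 1) :=
    (segmentSupport n).continuous.continuousOn.integrableOn_compact (isCompact_closedBall _ _)
  have := (ContinuousMap.evalCLM ℝ u).integral_comp_comm hint
  rw [setAverage_eq, ContinuousMap.smul_apply, smul_eq_mul]
  congr 1
  exact this.symm

/-- Support functions of zonotopes form a convex set in the uniform norm, and an average of its
members lies in its closure. -/
theorem exists_zonotope_isSupportFunction_dist_lt {δ : ℝ} (hδ : 0 < δ) :
    ∃ (Z : Body n) (φ : C(ClosedUnitBall n, ℝ)),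
      IsZonotope Z ∧ IsSupportFunction Z φ ∧
        dist φ (⨍ v in Metric.closedBall (0 : EuclideanSpace ℝ (Fin n)) 1, segmentSupport n v) <
          δ := by
  let S : Set C(ClosedUnitBall n, ℝ) :=
    {φ | ∃ Z : Body n, IsZonotope Z ∧ IsSupportFunction Z φ}
  have hS : Convex ℝ S := by
    rintro φ ⟨Y, hY, hYφ⟩ ψ ⟨Z, hZ, hZψ⟩ a b ha hb -
    exact ⟨a • Y + b • Z, (hY.smul a).add (hZ.smul b), (hYφ.smul ha).add (hZψ.smul hb)⟩
  have hmem := hS.set_average_mem_closure (μ := volume) (f := segmentSupport n)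
    (Metric.measure_closedBall_pos volume (0 : EuclideanSpace ℝ (Fin n)) one_pos).ne'
    measure_closedBall_lt_top.ne
    (.of_forall fun v => ⟨_, .segmentBody v, isSupportFunction_segmentBody v⟩)
    ((segmentSupport n).continuous.continuousOn.integrableOn_compact (isCompact_closedBall _ _))
  obtain ⟨φ, ⟨Z, hZ, hφ⟩, hd⟩ := Metric.mem_closure_iff.1 hmem δ hδ
  exact ⟨Z, φ, hZ, hφ, by rwa [dist_comm]⟩

theorem IsSupportFunction.subset_closedBall {Z : Body n}
    {φ : C(ClosedUnitBall n, ℝ)}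
    (hZ : IsSupportFunction Z φ) {R : ℝ} (hR : 0 ≤ R)
    (h : ∀ u : ClosedUnitBall n,
      ‖(u : EuclideanSpace ℝ (Fin n))‖ = 1 → φ u ≤ R) :
    (Z : Set (EuclideanSpace ℝ (Fin n))) ⊆ Metric.closedBall 0 R := by
  intro z hz
  rw [mem_closedBall_zero_iff]
  rcases eq_or_ne z 0 with rfl | hz0
  · simpa using hR
  have hn : ‖(‖z‖⁻¹ : ℝ) • z‖ = 1 := by
    rw [norm_smul, norm_inv, norm_norm, inv_mul_cancel₀ (norm_ne_zero_iff.2 hz0)]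
  have h1 := ((hZ ⟨(‖z‖⁻¹ : ℝ) • z, by simp [hn]⟩).1 z hz).trans (h _ hn)
  rwa [inner_smul_left, real_inner_self_eq_norm_sq, sq, RCLike.conj_to_real,
    inv_mul_cancel_left₀ (norm_ne_zero_iff.2 hz0)] at h1

/-- A point of the ball outside `Z` would be strictly separated from `Z`, forcing a support value
below `R` in the separating direction. -/
theorem IsSupportFunction.closedBall_subset {Z : Body n}
    {φ : C(ClosedUnitBall n, ℝ)}
    (hZ : IsSupportFunction Z φ) {R : ℝ}
    (h : ∀ u : ClosedUnitBall n,
      ‖(u : EuclideanSpace ℝ (Fin n))‖ = 1 → R ≤ φ u) :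
    Metric.closedBall 0 R ⊆ (Z : Set (EuclideanSpace ℝ (Fin n))) := by
  intro x hx
  by_contra hxZ
  obtain ⟨f, c, hf, hfx⟩ := geometric_hahn_banach_closed_point Z.convex Z.isClosed hxZ
  let w := (InnerProductSpace.toDual ℝ (EuclideanSpace ℝ (Fin n))).symm f
  have hw : ∀ y, inner ℝ w y = f y := fun y => InnerProductSpace.toDual_symm_apply
  have hw0 : w ≠ 0 := by
    intro h0
    obtain ⟨z, hz⟩ := Z.nonempty
    have h1 := hf z hz
    rw [← hw, h0, inner_zero_left] at h1
    rw [← hw, h0, inner_zero_left] at hfx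
    exact lt_asymm h1 hfx
  have hn : ‖(‖w‖⁻¹ : ℝ) • w‖ = 1 := by
    rw [norm_smul, norm_inv, norm_norm, inv_mul_cancel₀ (norm_ne_zero_iff.2 hw0)]
  obtain ⟨-, z, hz, hzφ⟩ := hZ ⟨(‖w‖⁻¹ : ℝ) • w, by simp [hn]⟩
  have h1 := h ⟨(‖w‖⁻¹ : ℝ) • w, by simp [hn]⟩ hn
  have h2 : inner ℝ ((‖w‖⁻¹ : ℝ) • w) x ≤ R := by
    refine (real_inner_le_norm _ _).trans ?_
    rw [hn, one_mul]
    simpa using hx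
  have h3 := h2.trans (h1.trans_eq hzφ.symm)
  simp only [inner_smul_left, RCLike.conj_to_real, hw] at h3
  have h4 := le_of_mul_le_mul_left h3 (inv_pos.2 (norm_pos_iff.2 hw0))
  exact absurd ((hf z hz).trans hfx) (not_lt.2 h4)

/-- The Euclidean ball is a limit of zonotopes. -/
theorem exists_zonotope_between_balls (hn : n ≠ 0) {ε : ℝ} (hε : 0 < ε) :
    ∃ Z : Body n, IsZonotope Z ∧ unitBall n ≤ Z ∧ Z ≤ (1 + ε) • unitBall n := by
  have : NeZero n := ⟨hn⟩
  obtain ⟨e, he⟩ : ∃ e : EuclideanSpace ℝ (Fin n), ‖e‖ = 1 :=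
    ⟨EuclideanSpace.single 0 1, by simp⟩
  -- The averaged support function is constantly `c` on the unit sphere: the limit body is a ball of
  -- radius `c`.
  set c := (volume.real (Metric.closedBall (0 : EuclideanSpace ℝ (Fin n)) 1))⁻¹ *
        ∫ v in Metric.closedBall (0 : EuclideanSpace ℝ (Fin n)) 1, max (inner ℝ e v) 0 with hc
  have hc0 : 0 < c := by
    refine mul_pos (inv_pos.2 ?_) (setIntegral_inner_posPart_pos he)
    exact ENNReal.toReal_pos (Metric.measure_closedBall_pos volume _ one_pos).ne'
      measure_closedBall_lt_top.ne
  -- Chosen so that `(c + δ) / (c - δ) = 1 + ε`.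
  set δ := c * ε / (2 + ε) with hδ
  have hδ0 : 0 < δ := by positivity
  obtain ⟨Z, φ, hZ, hφ, hd⟩ := exists_zonotope_isSupportFunction_dist_lt (n := n) hδ0
  have hφc : ∀ u : ClosedUnitBall n,
      ‖(u : EuclideanSpace ℝ (Fin n))‖ = 1 → |φ u - c| ≤ δ := by
    intro u hu
    have := (ContinuousMap.dist_apply_le_dist u).trans hd.le
    rwa [average_segmentSupport_apply, setIntegral_inner_posPart_eq (hu.trans he.symm), ← hc,
      Real.dist_eq] at this
  have hcδ : 0 < c - δ := by
    rw [hδ, sub_pos, div_lt_iff₀ (by positivity)]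
    nlinarith
  have hcδ' : (c - δ)⁻¹ * (c + δ) = 1 + ε := by
    rw [inv_mul_eq_iff_eq_mul₀ hcδ.ne', hδ]
    field_simp
    ring
  have hsup := hφ.smul (inv_nonneg.2 hcδ.le)
  refine ⟨(c - δ)⁻¹ • Z, hZ.smul _, hsup.closedBall_subset fun u hu => ?_, ?_⟩
  · have := (abs_le.1 (hφc u hu)).1
    rw [ContinuousMap.smul_apply, smul_eq_mul, inv_mul_eq_div, le_div_iff₀ hcδ]
    linarith
  · have hball : (((1 + ε) • unitBall n : Body n) : Set (EuclideanSpace ℝ (Fin n))) =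
        Metric.closedBall 0 (1 + ε) := by
      change (1 + ε) • Metric.closedBall (0 : EuclideanSpace ℝ (Fin n)) 1 = _
      rw [smul_unitClosedBall, Real.norm_of_nonneg (by positivity)]
    rw [← SetLike.coe_subset_coe, hball]
    refine hsup.subset_closedBall (by positivity) fun u hu => ?_
    have := (abs_le.1 (hφc u hu)).2
    rw [ContinuousMap.smul_apply, smul_eq_mul, ← hcδ']
    exact mul_le_mul_of_nonneg_left (by linarith) (inv_nonneg.2 hcδ.le)

/-! ### Steiner's formula for the ball -/

theorem coe_add_smul_unitBall (K : Body n) {t : ℝ} (ht : 0 ≤ t) :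
    ((K + t • unitBall n : Body n) : Set (EuclideanSpace ℝ (Fin n))) = Metric.cthickening t K := by
  change (K : Set (EuclideanSpace ℝ (Fin n))) + t • Metric.closedBall 0 1 = _
  rw [smul_unitClosedBall, Real.norm_of_nonneg ht, K.isCompact.add_closedBall_zero ht]

theorem tendsto_vol_add_smul_unitBall (K : Body n) {t : ℝ} (ht : 0 ≤ t) {ε : ℕ → ℝ}
    (hε0 : ∀ k, 0 ≤ ε k) (hε : Filter.Tendsto ε Filter.atTop (nhds 0)) :
    Filter.Tendsto (fun k => vol (K + (t + ε k) • unitBall n)) Filter.atTop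
      (nhds (vol (K + t • unitBall n))) := by
  have h := (tendsto_measure_cthickening_of_isCompact (μ := volume)
    (K + t • unitBall n).isCompact).comp hε
  have := (ENNReal.tendsto_toReal (volume_ne_top _)).comp h
  refine this.congr fun k => ?_
  simp only [Function.comp, vol]
  rw [coe_add_smul_unitBall K (add_nonneg ht (hε0 k)), coe_add_smul_unitBall K ht,
    cthickening_cthickening (hε0 k) ht, add_comm]

theorem smul_le_smul_body {K L : Body n} (h : K ≤ L) (t : ℝ) : t • K ≤ t • L :=
  smul_set_mono (s := (K : Set (EuclideanSpace ℝ (Fin n)))) h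

theorem add_le_add_body (K : Body n) {L M : Body n} (h : L ≤ M) : K + L ≤ K + M :=
  add_subset_add_left (s := (K : Set (EuclideanSpace ℝ (Fin n)))) h

/-- Steiner's formula for the Euclidean ball. -/
theorem exists_isSteinerPolynomial_unitBall (K : Body n) :
    ∃ p, IsSteinerPolynomial K (unitBall n) p := by
  -- In dimension 0 there is no unit vector, but every body is the whole space.
  rcases eq_or_ne n 0 with rfl | hn
  · refine ⟨C (vol K), by simp, fun t _ => ?_⟩
    rw [eval_C]
    congr 1
    exact SetLike.coe_injective ((ConvexBody.nonempty _).eq_univ.trans K.nonempty.eq_univ.symm)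
  let ε : ℕ → ℝ := fun k => 1 / ((k : ℝ) + 1)
  have hε0 : ∀ k, 0 < ε k := fun k => Nat.one_div_pos_of_nat
  choose Z hZ hZl hZu using fun k => exists_zonotope_between_balls hn (hε0 k)
  choose p hp using fun k => (hZ k).exists_isSteinerPolynomial K
  refine exists_polynomial_of_tendsto (fun k => (hp k).1) fun t ht => ?_
  have hlim : Filter.Tendsto (fun k => t * ε k) Filter.atTop (nhds 0) := by
    simpa [ε] using tendsto_one_div_add_atTop_nhds_zero_nat.const_mul t
  -- The zonotope volumes are squeezed between those for `t B` and `(t + t ε) B`.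
  refine tendsto_of_tendsto_of_tendsto_of_le_of_le tendsto_const_nhds
    (tendsto_vol_add_smul_unitBall K ht (fun k => mul_nonneg ht (hε0 k).le) hlim)
    (fun k => ?_) fun k => ?_
  · change _ ≤ (p k).eval t
    rw [← (hp k).2 t ht]
    exact vol_mono (add_le_add_body K (smul_le_smul_body (hZl k) t))
  · change (p k).eval t ≤ _
    rw [← (hp k).2 t ht]
    have := smul_le_smul_body (hZu k) t
    rw [smul_smul, mul_add, mul_one] at this
    exact vol_mono (add_le_add_body K this)

theorem isSteinerPolynomial_steinerPolynomial (K : Body n) :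
    IsSteinerPolynomial K (unitBall n) (steinerPolynomial K (unitBall n)) := by
  obtain ⟨p, hp⟩ := exists_isSteinerPolynomial_unitBall K
  rwa [hp.eq_steinerPolynomial]

/-! ### The Wills functional as a Gaussian integral -/

theorem kappa_eq (n : ℕ) :
    kappa n = Real.sqrt Real.pi ^ n / Real.Gamma ((n : ℝ) / 2 + 1) := by
  change (volume (Metric.closedBall (0 : EuclideanSpace ℝ (Fin n)) 1)).toReal = _
  rcases Nat.eq_zero_or_pos n with rfl | hn
  · rw [(Metric.nonempty_closedBall.2 zero_le_one).eq_univ, volume_euclideanSpace_eq_dirac]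
    simp
  · have : NeZero n := ⟨hn.ne'⟩
    rw [EuclideanSpace.volume_closedBall]
    simp only [ENNReal.ofReal_one, one_pow, one_mul, Fintype.card_fin]
    exact ENNReal.toReal_ofReal (div_nonneg (by positivity)
      (Real.Gamma_pos_of_pos (by positivity)).le)

/-- The density of the radial Gaussian weight: minus the derivative of `exp (-π t ^ 2)`. -/
noncomputable def gaussianWeight (t : ℝ) : ℝ := 2 * Real.pi * t * Real.exp (-Real.pi * t ^ 2)

theorem gaussianWeight_nonneg {t : ℝ} (ht : 0 ≤ t) : 0 ≤ gaussianWeight t := by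
  unfold gaussianWeight
  positivity

theorem measurable_gaussianWeight : Measurable gaussianWeight := by
  unfold gaussianWeight
  fun_prop

theorem lintegral_gaussianWeight_Ioi {a : ℝ} (ha : 0 ≤ a) :
    ∫⁻ t in Ioi a, ENNReal.ofReal (gaussianWeight t) =
      ENNReal.ofReal (Real.exp (-Real.pi * a ^ 2)) := by
  have hderiv : ∀ x ∈ Ici a, HasDerivAt (fun t => -Real.exp (-Real.pi * t ^ 2))
      (gaussianWeight x) x := by
    intro x _
    have := (((hasDerivAt_pow 2 x).const_mul (-Real.pi)).exp).neg
    refine this.congr_deriv ?_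
    simp only [gaussianWeight]
    push_cast
    ring
  have hpos : ∀ x ∈ Ioi a, 0 ≤ gaussianWeight x := fun x hx =>
    gaussianWeight_nonneg (ha.trans (le_of_lt hx))
  have hlim : Filter.Tendsto (fun t => -Real.exp (-Real.pi * t ^ 2)) Filter.atTop (nhds 0) := by
    rw [← neg_zero]
    refine (Real.tendsto_exp_atBot.comp ?_).neg
    exact (Filter.tendsto_pow_atTop two_ne_zero).const_mul_atTop_of_neg
      (neg_lt_zero.2 Real.pi_pos)
  rw [← ofReal_integral_eq_lintegral_ofReal (integrableOn_Ioi_deriv_of_nonneg' hderiv hpos hlim)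
    ((ae_restrict_iff' measurableSet_Ioi).2 (.of_forall hpos)),
    integral_Ioi_of_hasDerivAt_of_nonneg' hderiv hpos hlim]
  simp

theorem gaussianWeight_mul_pow (j : ℕ) {t : ℝ} (ht : 0 < t) :
    gaussianWeight t * t ^ j =
      2 * Real.pi * (t ^ ((j : ℝ) + 1) * Real.exp (-Real.pi * t ^ (2 : ℝ))) := by
  rw [gaussianWeight, Real.rpow_add_one ht.ne', Real.rpow_natCast, Real.rpow_two]
  ring

theorem integrableOn_gaussianWeight_mul_pow (j : ℕ) :
    IntegrableOn (fun t => gaussianWeight t * t ^ j) (Ioi 0) :=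
  IntegrableOn.congr_fun ((integrableOn_rpow_mul_exp_neg_mul_rpow (s := (j : ℝ) + 1)
    (by linarith [j.cast_nonneg (α := ℝ)]) two_pos Real.pi_pos).const_mul (2 * Real.pi))
      (fun _ ht => (gaussianWeight_mul_pow j ht).symm) measurableSet_Ioi

/-- A Gamma integral with value `Γ(j/2 + 1) / π^(j/2)`. The factor `π` in the exponent is what makes
it match the normalization of intrinsic volumes. -/
theorem integral_gaussianWeight_mul_pow (j : ℕ) :
    ∫ t in Ioi (0 : ℝ), gaussianWeight t * t ^ j = (kappa j)⁻¹ := by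
  rw [setIntegral_congr_fun measurableSet_Ioi fun t ht => gaussianWeight_mul_pow j ht,
    integral_const_mul, integral_rpow_mul_exp_neg_mul_rpow two_pos
      (by linarith [j.cast_nonneg (α := ℝ)]) Real.pi_pos, kappa_eq, inv_div]
  have e1 : ((j : ℝ) + 1 + 1) / 2 = (j : ℝ) / 2 + 1 := by ring
  have e2 : Real.pi ^ (-((j : ℝ) + 1 + 1) / 2) = (Real.pi * Real.sqrt Real.pi ^ j)⁻¹ := by
    rw [neg_div, Real.rpow_neg Real.pi_pos.le, e1, Real.rpow_add_one Real.pi_pos.ne',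
      Real.sqrt_eq_rpow, ← Real.rpow_natCast, ← Real.rpow_mul Real.pi_pos.le, mul_comm]
    congr 3
    ring
  rw [e1, e2]
  have := Real.pi_pos
  field_simp

/-- The binomial coefficients cancel, and `i ↦ n - i` reverses the sum. -/
theorem wills_eq_sum (K : Body n) :
    wills K = ∑ j ∈ Finset.range (n + 1),
      (steinerPolynomial K (unitBall n)).coeff j * (kappa j)⁻¹ := by
  rw [wills, ← Finset.sum_range_reflect]
  refine Finset.sum_congr rfl fun j hj => ?_
  have hj' : j ≤ n := Nat.lt_succ_iff.1 (Finset.mem_range.1 hj)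
  have hc : (n.choose j : ℝ) ≠ 0 := by exact_mod_cast (Nat.choose_pos hj').ne'
  rw [show n + 1 - 1 - j = n - j by omega, intrinsicVolume, quermassintegral,
    Nat.sub_sub_self hj', Nat.choose_symm hj', div_mul_div_comm, div_eq_mul_inv, mul_inv]
  field_simp

theorem integral_gaussianWeight_mul_eval {p : ℝ[X]} (hp : p.natDegree ≤ n) :
    IntegrableOn (fun t => gaussianWeight t * p.eval t) (Ioi 0) ∧
      ∫ t in Ioi (0 : ℝ), gaussianWeight t * p.eval t =
        ∑ j ∈ Finset.range (n + 1), p.coeff j * (kappa j)⁻¹ := by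
  have e : ∀ t, gaussianWeight t * p.eval t =
      ∑ j ∈ Finset.range (n + 1), p.coeff j * (gaussianWeight t * t ^ j) := by
    intro t
    rw [eval_eq_sum_range' (Nat.lt_succ_iff.2 hp), Finset.mul_sum]
    exact Finset.sum_congr rfl fun j _ => by ring
  have hint : ∀ j ∈ Finset.range (n + 1), IntegrableOn
      (fun t => p.coeff j * (gaussianWeight t * t ^ j)) (Ioi 0) := fun j _ =>
    (integrableOn_gaussianWeight_mul_pow j).const_mul _
  simp_rw [e]
  refine ⟨integrable_finsetSum _ hint, ?_⟩
  rw [integral_finsetSum _ hint]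
  simp_rw [integral_const_mul, integral_gaussianWeight_mul_pow]

theorem zero_mem_interior_unitBall (n : ℕ) : (0 : EuclideanSpace ℝ (Fin n)) ∈
    interior (unitBall n : Set (EuclideanSpace ℝ (Fin n))) :=
  mem_interior_iff_mem_nhds.2 (Metric.closedBall_mem_nhds 0 one_pos)

/-- The function `t ↦ π t ^ 2`, whose generalized Wills functional is the Wills functional. -/
noncomputable def gaussianExponent (t : ℝ≥0) : EReal := ((Real.pi * (t : ℝ) ^ 2 : ℝ) : EReal)

theorem isConvexIncreasing_gaussianExponent : IsConvexIncreasing gaussianExponent where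
  ne_bot t := EReal.coe_ne_bot _
  convex s t a b ha hb hab := by
    have hab' : (a : ℝ) + b = 1 := by exact_mod_cast hab
    unfold gaussianExponent
    rw [← EReal.coe_mul, ← EReal.coe_mul, ← EReal.coe_add, EReal.coe_le_coe_iff]
    have h := (convexOn_pow 2).2 (mem_Ici.2 s.coe_nonneg) (mem_Ici.2 t.coe_nonneg) a.coe_nonneg
      b.coe_nonneg hab'
    simp only [smul_eq_mul] at h
    push_cast
    nlinarith [mul_le_mul_of_nonneg_left h Real.pi_pos.le]
  monotone s t hst := by
    have h : (s : ℝ) ≤ t := hst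
    unfold gaussianExponent
    rw [EReal.coe_le_coe_iff]
    gcongr
  continuousOn := (continuous_coe_real_ereal.comp (by fun_prop)).continuousOn

/-- The Wills functional as a Gaussian integral of the distance function. -/
theorem genWills_gaussianExponent (K : Body n) :
    genWills gaussianExponent K (unitBall n) = ENNReal.ofReal (wills K) := by
  have hE := zero_mem_interior_unitBall n
  have hp := isSteinerPolynomial_steinerPolynomial K
  have hd : Measurable fun x => (relDist (unitBall n) x K : ℝ) :=
    (measurable_relDist hE K).coe_nnreal_real
  -- Integrating `F` over `t` gives the Gaussian of the distance; integrating over `x` gives the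
  -- weight times `vol (K + t B)`.
  let F : EuclideanSpace ℝ (Fin n) → ℝ → ℝ≥0∞ := fun x t =>
    {p : EuclideanSpace ℝ (Fin n) × ℝ | (relDist (unitBall n) p.1 K : ℝ) ≤ p.2}.indicator
      (fun p => ENNReal.ofReal (gaussianWeight p.2)) (x, t)
  have hF : Measurable (Function.uncurry F) :=
    (measurable_gaussianWeight.comp measurable_snd).ennreal_ofReal.indicator
      (measurableSet_le (hd.comp measurable_fst) measurable_snd)
  have h1 : ∀ x, EReal.exp (-gaussianExponent (relDist (unitBall n) x K)) =
      ∫⁻ t in Ioi 0, F x t := by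
    intro x
    rw [gaussianExponent, ← EReal.coe_neg, EReal.exp_coe, ← neg_mul,
      ← lintegral_gaussianWeight_Ioi (NNReal.coe_nonneg _), setLIntegral_congr Ioi_ae_eq_Ici,
      setLIntegral_congr (Ioi_ae_eq_Ici (a := (0 : ℝ)))]
    change _ = ∫⁻ t in Ici 0, (Ici (relDist (unitBall n) x K : ℝ)).indicator
      (fun t => ENNReal.ofReal (gaussianWeight t)) t
    rw [setLIntegral_indicator measurableSet_Ici,
      inter_eq_left.2 (Ici_subset_Ici.2 (NNReal.coe_nonneg _))]
  have h2 : ∀ t ∈ Ioi (0 : ℝ), ∫⁻ x, F x t = ENNReal.ofReal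
      (gaussianWeight t * (steinerPolynomial K (unitBall n)).eval t) := by
    intro t ht
    have hS : ∀ x, F x t = ((K + t • unitBall n : Body n) :
        Set (EuclideanSpace ℝ (Fin n))).indicator (fun _ => ENNReal.ofReal (gaussianWeight t)) x := by
      intro x
      have : (relDist (unitBall n) x K : ℝ) ≤ t ↔ x ∈ K + t • unitBall n :=
        relDist_le_iff (t := ⟨t, le_of_lt ht⟩) hE
      by_cases h : x ∈ K + t • unitBall n
      · rw [indicator_of_mem (SetLike.mem_coe.2 h)]
        exact indicator_of_mem (α := EuclideanSpace ℝ (Fin n) × ℝ) (a := (x, t)) (this.2 h) _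
      · rw [indicator_of_notMem (SetLike.mem_coe.not.2 h)]
        exact indicator_of_notMem (α := EuclideanSpace ℝ (Fin n) × ℝ) (a := (x, t))
          (this.not.2 h) _
    simp_rw [hS]
    rw [lintegral_indicator_const (ConvexBody.isClosed _).measurableSet,
      ENNReal.ofReal_mul (gaussianWeight_nonneg (le_of_lt ht)), ← hp.2 t (le_of_lt ht), vol,
      ENNReal.ofReal_toReal (volume_ne_top _)]
  obtain ⟨hint, hval⟩ := integral_gaussianWeight_mul_eval hp.1
  rw [genWills]
  simp_rw [h1]
  rw [lintegral_lintegral_swap hF.aemeasurable, setLIntegral_congr_fun measurableSet_Ioi h2,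
    ← ofReal_integral_eq_lintegral_ofReal hint, hval, wills_eq_sum]
  refine (ae_restrict_iff' measurableSet_Ioi).2 (.of_forall fun t ht => ?_)
  change 0 ≤ gaussianWeight t * _
  rw [← hp.2 t (le_of_lt ht)]
  exact mul_nonneg (gaussianWeight_nonneg (le_of_lt ht)) ENNReal.toReal_nonneg

/-- Needed to return from `[0, ∞]` to real numbers; the integral of a nonnegative volume gives it
without the signs of the single intrinsic volumes. -/
theorem wills_nonneg (K : Body n) : 0 ≤ wills K := by
  have hp := isSteinerPolynomial_steinerPolynomial K
  rw [wills_eq_sum, ← (integral_gaussianWeight_mul_eval hp.1).2]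
  refine setIntegral_nonneg measurableSet_Ioi fun t ht => ?_
  rw [← hp.2 t (le_of_lt ht)]
  exact mul_nonneg (gaussianWeight_nonneg (le_of_lt ht)) ENNReal.toReal_nonneg

/-- Log-concavity of the Wills functional. -/
theorem wills_rpow_mul_le (K L : Body n) {l : ℝ} (h0 : 0 < l) (h1 : l < 1) :
    wills K ^ (1 - l) * wills L ^ l ≤ wills ((1 - l) • K + l • L) := by
  have h := genWills_rpow_mul_le (zero_mem_interior_unitBall n)
    isConvexIncreasing_gaussianExponent K L h0 h1
  simp only [genWills_gaussianExponent] at h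
  rw [ENNReal.ofReal_rpow_of_nonneg (wills_nonneg K) (sub_nonneg.2 h1.le),
    ENNReal.ofReal_rpow_of_nonneg (wills_nonneg L) h0.le,
    ← ENNReal.ofReal_mul (Real.rpow_nonneg (wills_nonneg K) _),
    ENNReal.ofReal_le_ofReal_iff (wills_nonneg _)] at h
  exact h

end WillsFunctional

theorem theorem1p5 (n : ℕ) :
    (∀ (K L : WillsFunctional.Body n) (l : ℝ), 0 < l → l < 1 →
      WillsFunctional.wills ((1 - l) • K + l • L) ≥
        WillsFunctional.wills K ^ (1 - l) * WillsFunctional.wills L ^ l) ∧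
    (∀ (E : WillsFunctional.Body n),
      (0 : EuclideanSpace ℝ (Fin n)) ∈ interior (E : Set (EuclideanSpace ℝ (Fin n))) →
      ∀ (u : ℝ≥0 → EReal), WillsFunctional.IsConvexIncreasing u →
      ∀ (K L : WillsFunctional.Body n) (l : ℝ), 0 < l → l < 1 →
        WillsFunctional.genWills u ((1 - l) • K + l • L) E ≥
          WillsFunctional.genWills u K E ^ (1 - l) * WillsFunctional.genWills u L E ^ l) :=
  ⟨fun K L _ h0 h1 => WillsFunctional.wills_rpow_mul_le K L h0 h1,
    fun _ hE _ hu K L _ h0 h1 => WillsFunctional.genWills_rpow_mul_le hE hu K L h0 h1⟩
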